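/- All graphs are finite and simple. The valency of a vertex is its degree. A real number $\mu$ is a main eigenvalue of a graph $G$ if it is an eigenvalue of the $(0,1)$-adjacency matrix of $G$ having an eigenvector that is not orthogonal to the all-one vector. Let $t \ge 3$ and let $H$ be a graph on $n$ vertices with exactly $t$ distinct valencies. Then there exists a connected graph $G$ on at most $2^{n+2}$ vertices such that $G$ has exactly two main eigenvalues, $G$ has at least $t$ distinct valencies, and $G$ contains $H$ as an induced subgraph (up to isomorphism). -/

import Mathlib

/-- The set of distinct valencies (vertex degrees) of a finite graph. -/
def SimpleGraph.valencies {V : Type*} [Fintype V] (G : SimpleGraph V) [DecidableRel G.Adj] :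
    Finset ℕ :=
  Finset.univ.image fun v => G.degree v

/-- The main eigenvalues of a finite graph: the eigenvalues of its real adjacency matrix that
have an eigenvector not orthogonal to the all-one vector. (The adjacency matrix is real
symmetric, so all its eigenvalues are real.) -/
def SimpleGraph.mainEigenvalues {V : Type*} [Fintype V] [DecidableEq V] (G : SimpleGraph V)
    [DecidableRel G.Adj] : Set ℝ :=
  {μ | ∃ x : V → ℝ,
    Module.End.HasEigenvector (Matrix.toLin' (G.adjMatrix ℝ)) μ x ∧ x ⬝ᵥ (1 : V → ℝ) ≠ 0}

/-!
A graph whose adjacency matrix `A` satisfies `A² 1 = a • A 1 + b • 1`, and which is not regular,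
has exactly two main eigenvalues, namely the two roots of `X² - a X - b`: a main eigenvector `x`
has `x ⬝ᵥ 1 ≠ 0`, and pairing the relation with `x` shows that its eigenvalue is a root, while for
roots `μ, ν` the vector `A 1 - ν • 1` is an eigenvector for `μ` that is not orthogonal to `1`.

The relation holds with `a = 0` as soon as the degrees of the neighbours of each vertex sum up to
the same number `P`. This property passes to disjoint unions. A complete bipartite graph `K_{p,q}`
has it with `P = p q`, and an `r`-regular graph has it with `P = r²`. So for `P = 4 ^ m` the
disjoint union of `K_{1, 4 ^ m}, K_{2, 4 ^ m / 2}, …, K_{2 ^ m, 2 ^ m}` and of any `2 ^ m`-regular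
graph has it, and this union has the `2 m + 1` valencies `1, 2, 4, …, 4 ^ m`. Every graph on `n`
vertices is an induced subgraph of an `r`-regular one on `2 n (r - n + 2)` vertices if `n ≤ r + 1`;
this is applied with `m = ⌊n / 2⌋` and `r = 2 ^ m` to the complement of the given graph.

Passing to the complement of the whole union gives the graph required: the complement of a
disconnected graph is connected, a relation `A² 1 = P • 1` becomes one of the form
`B² 1 = a • B 1 + b • 1` for the complement, and the number of valencies does not change.
-/

open Finset Matrix

namespace SimpleGraph

/-! ### Two main eigenvalues -/

/-- A real symmetric matrix for which the all-one vector generates a two-dimensional invariant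
subspace has exactly two eigenvalues with an eigenvector not orthogonal to that vector. -/
theorem ncard_mainEigenvalues_of_isSymm {V : Type*} [Fintype V] [DecidableEq V]
    {M : Matrix V V ℝ} (hM : M.IsSymm) {a b : ℝ} (h : M *ᵥ (M *ᵥ 1) = a • (M *ᵥ 1) + b • 1)
    (hne : ∀ c : ℝ, M *ᵥ 1 ≠ c • 1) :
    {μ | ∃ x : V → ℝ, Module.End.HasEigenvector (toLin' M) μ x ∧ x ⬝ᵥ (1 : V → ℝ) ≠ 0}.ncard
      = 2 := by
  have adj (x y : V → ℝ) : (M *ᵥ x) ⬝ᵥ y = x ⬝ᵥ (M *ᵥ y) := by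
    rw [dotProduct_mulVec, ← mulVec_transpose, hM.eq]
  have hpos (c : ℝ) : 0 < (M *ᵥ 1 - c • 1) ⬝ᵥ (M *ᵥ 1 - c • 1) := by
    refine lt_of_le_of_ne (Finset.sum_nonneg fun i _ => mul_self_nonneg _) fun h0 => hne c ?_
    exact sub_eq_zero.1 (dotProduct_self_eq_zero.1 h0.symm)
  have h11 : (M *ᵥ 1) ⬝ᵥ (M *ᵥ 1) = a * ((M *ᵥ 1) ⬝ᵥ 1) + b * (1 ⬝ᵥ (1 : V → ℝ)) := by
    rw [← adj, h, add_dotProduct, smul_dotProduct, smul_dotProduct, smul_eq_mul, smul_eq_mul]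
  have hN : (0 : ℝ) ≤ 1 ⬝ᵥ (1 : V → ℝ) := Finset.sum_nonneg fun i _ => mul_self_nonneg _
  have expand (c : ℝ) : (M *ᵥ 1 - c • 1) ⬝ᵥ (M *ᵥ 1 - c • 1) =
      (a - 2 * c) * ((M *ᵥ 1) ⬝ᵥ 1) + (b + c ^ 2) * (1 ⬝ᵥ (1 : V → ℝ)) := by
    simp only [sub_dotProduct, dotProduct_sub, smul_dotProduct, dotProduct_smul, h11, smul_eq_mul,
      dotProduct_comm 1 (M *ᵥ 1)]
    ring
  -- The vector `A 1 - (a / 2) • 1` has positive norm, so the discriminant is positive.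
  have hD : 0 < a ^ 2 + 4 * b := by
    have h1 := hpos (a / 2)
    rw [expand] at h1
    by_contra hD
    nlinarith
  set s := √(a ^ 2 + 4 * b)
  have hs : 0 < s := Real.sqrt_pos.2 hD
  have hss : s * s = a ^ 2 + 4 * b := Real.mul_self_sqrt hD.le
  -- For roots `μ, ν` the vector `x = A 1 - ν • 1` is an eigenvector for `μ`. If it were orthogonal
  -- to `1`, then also to `A 1`, since `x ⬝ᵥ A 1 = A x ⬝ᵥ 1`, hence to itself.
  have key (μ ν : ℝ) (hsum : μ + ν = a) (hprod : μ * ν = -b) :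
      ∃ x : V → ℝ, Module.End.HasEigenvector (toLin' M) μ x ∧ x ⬝ᵥ (1 : V → ℝ) ≠ 0 := by
    have hx : M *ᵥ (M *ᵥ 1 - ν • 1) = μ • (M *ᵥ 1 - ν • 1) := by
      rw [mulVec_sub, h, mulVec_smul, ← hsum, smul_sub, smul_smul, hprod]
      module
    refine ⟨M *ᵥ 1 - ν • 1, ⟨?_, sub_ne_zero.2 (hne ν)⟩, fun h0 => (hpos ν).ne' ?_⟩
    · rw [Module.End.mem_eigenspace_iff, toLin'_apply, hx]
    · rw [dotProduct_sub, dotProduct_smul, h0, ← adj, hx, smul_dotProduct, h0]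
      simp
  have hset : {μ | ∃ x : V → ℝ, Module.End.HasEigenvector (toLin' M) μ x ∧
      x ⬝ᵥ (1 : V → ℝ) ≠ 0} = {(a + s) / 2, (a - s) / 2} := by
    ext μ
    simp only [Set.mem_ofPred_eq, Set.mem_insert_iff, Set.mem_singleton_iff]
    constructor
    · rintro ⟨x, hx, hx1⟩
      have hx' : M *ᵥ x = μ • x := by simpa using hx.apply_eq_smul
      have h2 : x ⬝ᵥ (M *ᵥ (M *ᵥ 1)) = μ * (μ * (x ⬝ᵥ 1)) := by
        rw [← adj, hx', smul_dotProduct, ← adj, hx', smul_dotProduct, smul_eq_mul, smul_eq_mul]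
      rw [h, dotProduct_add, dotProduct_smul, dotProduct_smul, ← adj, hx', smul_dotProduct,
        smul_eq_mul, smul_eq_mul, smul_eq_mul] at h2
      have h3 : (μ - (a + s) / 2) * (μ - (a - s) / 2) = 0 := by
        apply mul_right_cancel₀ hx1
        linear_combination -h2 - (x ⬝ᵥ (1 : V → ℝ)) / 4 * hss
      rcases mul_eq_zero.1 h3 with h4 | h4
      · exact Or.inl (sub_eq_zero.1 h4)
      · exact Or.inr (sub_eq_zero.1 h4)
    · rintro (rfl | rfl)
      · exact key _ ((a - s) / 2) (by ring) (by linear_combination -hss / 4)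
      · exact key _ ((a + s) / 2) (by ring) (by linear_combination -hss / 4)
  rw [hset, Set.ncard_pair]
  intro h0
  linarith

/-! ### Constant neighbour degree sums -/

/-- The degrees of the neighbours of each vertex sum up to `P`; in terms of the adjacency matrix
`A` this says `A² 1 = P • 1`. -/
def HasNeighborDegreeSum {V : Type*} [Fintype V] (G : SimpleGraph V) [DecidableRel G.Adj]
    (P : ℕ) : Prop :=
  ∀ v, ∑ w ∈ G.neighborFinset v, G.degree w = P

theorem neighborFinset_sum_inl {V W : Type*} [Fintype V] [Fintype W] {G : SimpleGraph V}
    {F : SimpleGraph W} [DecidableRel G.Adj] [DecidableRel (G ⊕g F).Adj] (v : V) :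
    (G ⊕g F).neighborFinset (.inl v) = (G.neighborFinset v).map .inl := by
  ext (w | w) <;> simp

theorem neighborFinset_sum_inr {V W : Type*} [Fintype V] [Fintype W] {G : SimpleGraph V}
    {F : SimpleGraph W} [DecidableRel F.Adj] [DecidableRel (G ⊕g F).Adj] (v : W) :
    (G ⊕g F).neighborFinset (.inr v) = (F.neighborFinset v).map .inr := by
  ext (w | w) <;> simp

theorem degree_sum_inl {V W : Type*} [Fintype V] [Fintype W] {G : SimpleGraph V}
    {F : SimpleGraph W} [DecidableRel G.Adj] [DecidableRel (G ⊕g F).Adj] (v : V) :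
    (G ⊕g F).degree (.inl v) = G.degree v := by
  rw [← card_neighborFinset_eq_degree, neighborFinset_sum_inl, Finset.card_map,
    card_neighborFinset_eq_degree]

theorem degree_sum_inr {V W : Type*} [Fintype V] [Fintype W] {G : SimpleGraph V}
    {F : SimpleGraph W} [DecidableRel F.Adj] [DecidableRel (G ⊕g F).Adj] (v : W) :
    (G ⊕g F).degree (.inr v) = F.degree v := by
  rw [← card_neighborFinset_eq_degree, neighborFinset_sum_inr, Finset.card_map,
    card_neighborFinset_eq_degree]

theorem valencies_subset_sum {V W : Type*} [Fintype V] [Fintype W] {G : SimpleGraph V}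
    {F : SimpleGraph W} [DecidableRel G.Adj] [DecidableRel (G ⊕g F).Adj] :
    G.valencies ⊆ (G ⊕g F).valencies := by
  intro d
  simp only [valencies, Finset.mem_image, Finset.mem_univ, true_and]
  rintro ⟨v, rfl⟩
  exact ⟨.inl v, degree_sum_inl v⟩

section

variable {V W : Type*} [Fintype V] [Fintype W] {G : SimpleGraph V} {F : SimpleGraph W}
  [DecidableRel G.Adj] [DecidableRel F.Adj]

theorem IsRegularOfDegree.hasNeighborDegreeSum {r : ℕ} (h : G.IsRegularOfDegree r) :
    G.HasNeighborDegreeSum (r * r) := by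
  intro v
  rw [Finset.sum_congr rfl fun w _ => h w, Finset.sum_const, card_neighborFinset_eq_degree, h v,
    smul_eq_mul]

theorem Iso.hasNeighborDegreeSum (e : G ≃g F) {P : ℕ} (h : G.HasNeighborDegreeSum P) :
    F.HasNeighborDegreeSum P := by
  intro v
  rw [← h (e.symm v)]
  refine Finset.sum_equiv e.symm.toEquiv (fun w => ?_) fun w _ => (e.symm.degree_eq w).symm
  rw [mem_neighborFinset, mem_neighborFinset]
  exact (e.symm.map_adj_iff).symm

theorem Iso.valencies_eq (e : G ≃g F) : G.valencies = F.valencies := by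
  ext d
  simp only [valencies, Finset.mem_image, Finset.mem_univ, true_and]
  exact ⟨fun ⟨v, hv⟩ => ⟨e v, by rw [e.degree_eq, hv]⟩,
    fun ⟨v, hv⟩ => ⟨e.symm v, by rw [e.symm.degree_eq, hv]⟩⟩

theorem HasNeighborDegreeSum.sum [DecidableRel (G ⊕g F).Adj] {P : ℕ}
    (hG : G.HasNeighborDegreeSum P) (hF : F.HasNeighborDegreeSum P) :
    (G ⊕g F).HasNeighborDegreeSum P := by
  rintro (v | v)
  · rw [neighborFinset_sum_inl, Finset.sum_map, ← hG v]
    exact Finset.sum_congr rfl fun w _ => degree_sum_inl w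
  · rw [neighborFinset_sum_inr, Finset.sum_map, ← hF v]
    exact Finset.sum_congr rfl fun w _ => degree_sum_inr w

theorem card_valencies_compl [DecidableEq V] : Gᶜ.valencies.card = G.valencies.card := by
  have h : Gᶜ.valencies = G.valencies.image fun d => Fintype.card V - 1 - d := by
    simp only [valencies, Finset.image_image]
    exact Finset.image_congr fun v _ => G.degree_compl v
  rw [h, Finset.card_image_of_injOn]
  intro d hd e he hde
  simp only [valencies, Finset.coe_image, Finset.coe_univ, Set.image_univ, Set.mem_range] at hd he
  obtain ⟨v, rfl⟩ := hd
  obtain ⟨w, rfl⟩ := he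
  have hv := G.degree_lt_card_verts v
  have hw := G.degree_lt_card_verts w
  simp only at hde
  omega

theorem adjMatrix_mulVec_one : G.adjMatrix ℝ *ᵥ 1 = fun v => (G.degree v : ℝ) := by
  ext v
  simp [adjMatrix_mulVec_apply]

/-- If `A² 1 = P • 1`, then the adjacency matrix `B = J - 1 - A` of the complement leaves the span
of `1` and `A 1` invariant. -/
theorem HasNeighborDegreeSum.ncard_mainEigenvalues_compl [DecidableEq V] {P : ℕ}
    (h : G.HasNeighborDegreeSum P) (hG : 1 < G.valencies.card) :
    Gᶜ.mainEigenvalues.ncard = 2 := by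
  have hB (x : V → ℝ) (v : V) :
      (Gᶜ.adjMatrix ℝ *ᵥ x) v = ∑ w, x w - x v - ∑ w ∈ G.neighborFinset v, x w := by
    rw [adjMatrix_mulVec_apply, neighborFinset_compl, Finset.sum_sdiff_eq_sub (by simp),
      Finset.sum_singleton, ← Finset.sum_add_sum_compl (G.neighborFinset v) x]
    ring
  have hdeg (v : V) : (Gᶜ.degree v : ℝ) = Fintype.card V - 1 - G.degree v := by
    have := hB 1 v
    rw [adjMatrix_mulVec_one] at this
    simpa using this
  have hP (v : V) : ∑ w ∈ G.neighborFinset v, (G.degree w : ℝ) = P := by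
    exact_mod_cast h v
  refine ncard_mainEigenvalues_of_isSymm (Gᶜ.isSymm_adjMatrix) (a := Fintype.card V - 2)
    (b := Fintype.card V - 1 + P - ∑ w, (G.degree w : ℝ)) ?_ fun c hc => ?_
  · ext v
    rw [hB]
    simp only [adjMatrix_mulVec_one, Pi.add_apply, Pi.smul_apply, smul_eq_mul, Pi.one_apply,
      hdeg, Finset.sum_sub_distrib, hP]
    simp
    ring
  · obtain ⟨d, hd, e, he, hde⟩ := Finset.one_lt_card.1 hG
    simp only [valencies, Finset.mem_image, Finset.mem_univ, true_and] at hd he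
    obtain ⟨v, rfl⟩ := hd
    obtain ⟨w, rfl⟩ := he
    rw [adjMatrix_mulVec_one] at hc
    have hv := congrFun hc v
    have hw := congrFun hc w
    simp only [Pi.smul_apply, Pi.one_apply, hdeg] at hv hw
    exact hde (by exact_mod_cast (by linarith : (G.degree v : ℝ) = G.degree w))

end

/-! ### Disjoint unions of complete bipartite graphs -/

/-- The disjoint union of the complete bipartite graphs `K_{p i, q i}`. -/
def bicliqueUnion {ι : Type*} (p q : ι → ℕ) : SimpleGraph (Σ i, Fin (p i) ⊕ Fin (q i)) where
  Adj x y := x.1 = y.1 ∧ x.2.isLeft ≠ y.2.isLeft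
  symm.symm _ _ h := ⟨h.1.symm, h.2.symm⟩
  loopless.irrefl _ h := h.2 rfl

theorem bicliqueUnion_adj {ι : Type*} {p q : ι → ℕ} {x y : Σ i, Fin (p i) ⊕ Fin (q i)} :
    (bicliqueUnion p q).Adj x y ↔ x.1 = y.1 ∧ x.2.isLeft ≠ y.2.isLeft :=
  Iff.rfl

section

variable {ι : Type*} [Fintype ι] {p q : ι → ℕ}
  [DecidableRel (bicliqueUnion p q).Adj]

theorem sum_neighborFinset_bicliqueUnion_inl (f : (Σ i, Fin (p i) ⊕ Fin (q i)) → ℕ) (i : ι)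
    (x : Fin (p i)) :
    ∑ w ∈ (bicliqueUnion p q).neighborFinset ⟨i, .inl x⟩, f w = ∑ y, f ⟨i, .inr y⟩ := by
  refine (Finset.sum_nbij (fun y => (⟨i, .inr y⟩ : Σ i, Fin (p i) ⊕ Fin (q i))) ?_ ?_ ?_ fun _ _ => rfl).symm
  · intro y _
    simp [bicliqueUnion_adj]
  · intro y _ z _ h
    simpa using h
  · rintro ⟨j, y | y⟩ h
    · simp [bicliqueUnion_adj] at h
    · simp only [coe_neighborFinset, mem_neighborSet, bicliqueUnion_adj] at h
      obtain rfl : i = j := h.1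
      exact ⟨y, by simp⟩

theorem sum_neighborFinset_bicliqueUnion_inr (f : (Σ i, Fin (p i) ⊕ Fin (q i)) → ℕ) (i : ι)
    (x : Fin (q i)) :
    ∑ w ∈ (bicliqueUnion p q).neighborFinset ⟨i, .inr x⟩, f w = ∑ y, f ⟨i, .inl y⟩ := by
  refine (Finset.sum_nbij (fun y => (⟨i, .inl y⟩ : Σ i, Fin (p i) ⊕ Fin (q i))) ?_ ?_ ?_ fun _ _ => rfl).symm
  · intro y _
    simp [bicliqueUnion_adj]
  · intro y _ z _ h
    simpa using h
  · rintro ⟨j, y | y⟩ h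
    · simp only [coe_neighborFinset, mem_neighborSet, bicliqueUnion_adj] at h
      obtain rfl : i = j := h.1
      exact ⟨y, by simp⟩
    · simp [bicliqueUnion_adj] at h

theorem degree_bicliqueUnion_inl (i : ι) (x : Fin (p i)) :
    (bicliqueUnion p q).degree ⟨i, .inl x⟩ = q i := by
  rw [← card_neighborFinset_eq_degree, Finset.card_eq_sum_ones,
    sum_neighborFinset_bicliqueUnion_inl]
  simp

theorem degree_bicliqueUnion_inr (i : ι) (x : Fin (q i)) :
    (bicliqueUnion p q).degree ⟨i, .inr x⟩ = p i := by
  rw [← card_neighborFinset_eq_degree, Finset.card_eq_sum_ones,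
    sum_neighborFinset_bicliqueUnion_inr]
  simp

theorem hasNeighborDegreeSum_bicliqueUnion {P : ℕ} (h : ∀ i, p i * q i = P) :
    (bicliqueUnion p q).HasNeighborDegreeSum P := by
  rintro ⟨i, x | x⟩
  · rw [sum_neighborFinset_bicliqueUnion_inl]
    simp [degree_bicliqueUnion_inr, ← h i, mul_comm]
  · rw [sum_neighborFinset_bicliqueUnion_inr]
    simp [degree_bicliqueUnion_inl, ← h i]

end

theorem card_le_card_valencies_bicliqueUnion (m : ℕ)
    [DecidableRel (bicliqueUnion (fun i : Fin (m + 1) => 2 ^ (i : ℕ))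
      fun i => 2 ^ (2 * m - i)).Adj] :
    2 * m + 1 ≤ (bicliqueUnion (fun i : Fin (m + 1) => 2 ^ (i : ℕ))
      fun i => 2 ^ (2 * m - i)).valencies.card := by
  rw [← Finset.card_range (2 * m + 1),
    ← Finset.card_image_of_injective _ (Nat.pow_right_injective le_rfl)]
  refine Finset.card_le_card fun d hd => ?_
  simp only [valencies, Finset.mem_image, Finset.mem_range, Finset.mem_univ, true_and] at hd ⊢
  obtain ⟨j, hj, rfl⟩ := hd
  rcases le_or_gt j m with hjm | hjm
  · exact ⟨⟨⟨j, by omega⟩, .inr ⟨0, by positivity⟩⟩, degree_bicliqueUnion_inr _ _⟩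
  · refine ⟨⟨⟨2 * m - j, by omega⟩, .inl ⟨0, by positivity⟩⟩, ?_⟩
    rw [degree_bicliqueUnion_inl]
    simp only
    congr 1
    omega

theorem sum_two_pow_add_two_pow (m : ℕ) :
    ∑ i : Fin (m + 1), (2 ^ (i : ℕ) + 2 ^ (2 * m - i)) + 1 = 2 ^ (2 * m + 1) + 2 ^ m := by
  have h (k : ℕ) (hk : k ≤ m + 1) :
      ∑ i ∈ Finset.range k, (2 ^ i + 2 ^ (2 * m - i)) + 1 + 2 ^ (2 * m + 1 - k) =
        2 ^ k + 2 ^ (2 * m + 1) := by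
    induction k with
    | zero => simp [add_comm]
    | succ k ih =>
      have ih := ih (by omega)
      rw [show 2 * m + 1 - k = (2 * m - k) + 1 by omega, pow_succ] at ih
      rw [Finset.sum_range_succ, show 2 * m + 1 - (k + 1) = 2 * m - k by omega, pow_succ 2 k]
      omega
  have h1 := h (m + 1) le_rfl
  rw [show 2 * m + 1 - (m + 1) = m by omega, pow_succ 2 m] at h1
  rw [Fin.sum_univ_eq_sum_range (fun i => 2 ^ i + 2 ^ (2 * m - i))]
  omega

/-! ### Induced subgraphs of regular graphs -/

/-- Two disjoint copies of a graph, where each vertex of the first copy is joined to the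
non-neighbours, other than itself, of the corresponding vertex of the second copy. -/
def regularDouble {V : Type*} (H : SimpleGraph V) : SimpleGraph (V × Bool) where
  Adj x y := (x.2 = y.2 ∧ H.Adj x.1 y.1) ∨ (x.2 ≠ y.2 ∧ Hᶜ.Adj x.1 y.1)
  symm.symm _ _ h := h.imp (fun h => ⟨h.1.symm, h.2.symm⟩) fun h => ⟨h.1.symm, h.2.symm⟩
  loopless.irrefl _ h := h.elim (fun h => H.irrefl h.2) fun h => h.1 rfl

theorem regularDouble_adj {V : Type*} {H : SimpleGraph V} {x y : V × Bool} :
    (regularDouble H).Adj x y ↔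
      (x.2 = y.2 ∧ H.Adj x.1 y.1) ∨ (x.2 ≠ y.2 ∧ x.1 ≠ y.1 ∧ ¬H.Adj x.1 y.1) := by
  simp only [← compl_adj]
  rfl

theorem isRegularOfDegree_regularDouble {V : Type*} [Fintype V] (H : SimpleGraph V)
    [DecidableRel (regularDouble H).Adj] :
    (regularDouble H).IsRegularOfDegree (Fintype.card V - 1) := by
  classical
  rintro ⟨v, b⟩
  -- The first projection maps the neighbours of a vertex bijectively to the other vertices of `H`.
  rw [← card_neighborFinset_eq_degree, ← Finset.card_univ, ← Finset.card_erase_of_mem (mem_univ v)]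
  refine Finset.card_nbij Prod.fst ?_ ?_ ?_
  · rintro ⟨w, c⟩ h
    simp only [coe_neighborFinset, mem_neighborSet, regularDouble_adj] at h
    simp only [Finset.coe_erase, Finset.coe_univ, Set.mem_sdiff, Set.mem_univ, true_and,
      Set.mem_singleton_iff]
    rintro rfl
    simp at h
  · rintro ⟨w, c⟩ h ⟨w', c'⟩ h' rfl
    simp only [coe_neighborFinset, mem_neighborSet, regularDouble_adj] at h h'
    have hc : c = c' := by cases b <;> cases c <;> cases c' <;> simp_all
    rw [hc]
  · intro w hw
    have hw' : v ≠ w := by simpa [eq_comm] using hw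
    by_cases hvw : H.Adj v w
    · exact ⟨(w, b), by simp [regularDouble_adj, hvw], rfl⟩
    · exact ⟨(w, !b), by simp [regularDouble_adj, hvw, hw'], rfl⟩

/-- The box product of the regular double with a complete graph `K_k` raises the degree by
`k - 1`. -/
theorem exists_isRegularOfDegree_isIndContained {V : Type*} [Fintype V] [Nonempty V]
    (H : SimpleGraph V) {k r : ℕ} (hk : 0 < k) (hr : k + Fintype.card V = r + 2) :
    ∃ (R : SimpleGraph ((V × Bool) × Fin k)) (_ : DecidableRel R.Adj),
      R.IsRegularOfDegree r ∧ H.IsIndContained R := by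
  classical
  refine ⟨regularDouble H □ (⊤ : SimpleGraph (Fin k)), inferInstance, fun x => ?_, ⟨⟨⟨fun v =>
    ((v, false), ⟨0, hk⟩), fun v w h => by simpa using h⟩, ?_⟩⟩⟩
  · rw [degree_boxProd, isRegularOfDegree_regularDouble H x.1, complete_graph_degree,
      Fintype.card_fin]
    have := Fintype.card_pos (α := V)
    omega
  · intro v w
    change (regularDouble H □ (⊤ : SimpleGraph (Fin k))).Adj ((v, false), ⟨0, hk⟩)
      ((w, false), ⟨0, hk⟩) ↔ _
    simp [regularDouble_adj]

theorem two_mul_le_two_pow {m : ℕ} (hm : 0 < m) : 2 * m ≤ 2 ^ m := by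
  induction m, hm using Nat.le_induction with
  | base => simp
  | succ m hm ih =>
    rw [pow_succ]
    omega

/-- The number of vertices of the union of bicliques and of the regular graph, added up. -/
theorem two_pow_add_mul_le {n m k : ℕ} (hn : 3 ≤ n) (hm : n = 2 * m ∨ n = 2 * m + 1)
    (hk : k + n = 2 ^ m + 2) :
    2 ^ (2 * m + 1) + 2 ^ m + n * 2 * k ≤ 2 ^ (n + 2) := by
  have h0 : 2 * m ≤ 2 ^ m := two_mul_le_two_pow (by omega)
  have h1 : 2 ^ (2 * m + 1) = 2 * (2 ^ m * 2 ^ m) := by rw [pow_succ, two_mul, pow_add]; ring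
  have h2 : 2 ≤ 2 ^ m := Nat.le_self_pow (by omega) 2
  rcases hm with rfl | rfl
  · have h3 : 2 ^ (2 * m + 2) = 4 * (2 ^ m * 2 ^ m) := by rw [pow_succ, h1]; ring
    have h4 : 4 ≤ 2 ^ m := by omega
    rw [h1, h3]
    generalize 2 ^ m = x at *
    zify at *
    have hk' : (k : ℤ) = x + 2 - 2 * m := by omega
    rw [hk']
    nlinarith [sq_nonneg ((x : ℤ) - 4 * m)]
  · have h3 : 2 ^ (2 * m + 1 + 2) = 8 * (2 ^ m * 2 ^ m) := by rw [pow_add, h1]; ring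
    rw [h1, h3]
    generalize 2 ^ m = x at *
    zify at *
    have hk' : (k : ℤ) = x + 1 - 2 * m := by omega
    rw [hk']
    nlinarith [sq_nonneg ((x : ℤ) - 4 * m)]

end SimpleGraph

open SimpleGraph in
theorem mainTheorem1 {V : Type*} [Fintype V] (H : SimpleGraph V) [DecidableRel H.Adj]
    (n t : ℕ) (ht : 3 ≤ t) (hn : Fintype.card V = n) (hH : H.valencies.card = t) :
    ∃ (N : ℕ) (G : SimpleGraph (Fin N)) (_ : DecidableRel G.Adj),
      N ≤ 2 ^ (n + 2) ∧
      G.Connected ∧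
      G.mainEigenvalues.ncard = 2 ∧
      t ≤ G.valencies.card ∧
      H.IsIndContained G := by
  classical
  have htn : t ≤ n := hH ▸ hn ▸ Finset.card_image_le
  have hV : Nonempty V := Fintype.card_pos_iff.1 (by omega)
  set m := n / 2 with hm
  have hmn : n = 2 * m ∨ n = 2 * m + 1 := by omega
  have h2m : 2 * m ≤ 2 ^ m := two_mul_le_two_pow (by omega)
  -- The complete graph `K_k` raises the degree of the regular double from `n - 1` to `2 ^ m`.
  obtain ⟨k, hk⟩ : ∃ k, k + n = 2 ^ m + 2 := ⟨2 ^ m + 2 - n, by omega⟩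
  obtain ⟨R, _, hR, hHR⟩ := exists_isRegularOfDegree_isIndContained Hᶜ (k := k) (r := 2 ^ m)
    (by omega) (by omega)
  have : Nonempty ((V × Bool) × Fin k) := ⟨⟨(hV.some, false), ⟨0, by omega⟩⟩⟩
  set B := bicliqueUnion (fun i : Fin (m + 1) => 2 ^ (i : ℕ)) fun i => 2 ^ (2 * m - i)
  have : Nonempty (Σ i : Fin (m + 1), Fin (2 ^ (i : ℕ)) ⊕ Fin (2 ^ (2 * m - i))) :=
    ⟨⟨0, .inl ⟨0, by positivity⟩⟩⟩
  have hF : (B ⊕g R).HasNeighborDegreeSum (2 ^ m * 2 ^ m) := by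
    refine (hasNeighborDegreeSum_bicliqueUnion fun i => ?_).sum hR.hasNeighborDegreeSum
    rw [← pow_add, ← pow_add]
    congr 1
    omega
  have hval : t ≤ (B ⊕g R).valencies.card :=
    le_trans (by omega) ((card_le_card_valencies_bicliqueUnion m).trans
      (Finset.card_le_card valencies_subset_sum))
  let e := Fintype.equivFin
    ((Σ i : Fin (m + 1), Fin (2 ^ (i : ℕ)) ⊕ Fin (2 ^ (2 * m - i))) ⊕ (V × Bool) × Fin k)
  have iso : B ⊕g R ≃g (B ⊕g R).map e.toEmbedding := Iso.map e _
  have hval' : t ≤ ((B ⊕g R).map e.toEmbedding).valencies.card := iso.valencies_eq ▸ hval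
  refine ⟨_, ((B ⊕g R).map e.toEmbedding)ᶜ, inferInstance, ?_, ?_, ?_, ?_, ?_⟩
  · have h1 := sum_two_pow_add_two_pow m
    have h2 := two_pow_add_mul_le (ht.trans htn) hmn hk
    simp only [Fintype.card_sum, Fintype.card_sigma, Fintype.card_prod, Fintype.card_fin,
      Fintype.card_bool, hn]
    omega
  · have : Nonempty (Fin (Fintype.card ((Σ i : Fin (m + 1),
        Fin (2 ^ (i : ℕ)) ⊕ Fin (2 ^ (2 * m - i))) ⊕ (V × Bool) × Fin k))) := e.symm.nonempty
    exact (connected_or_connected_compl _).resolve_left fun h =>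
      not_connected_sum (iso.connected_iff.2 h)
  · exact (iso.hasNeighborDegreeSum hF).ncard_mainEigenvalues_compl (by omega)
  · rwa [card_valencies_compl]
  · rw [← compl_isIndContained_compl, compl_compl]
    exact hHR.trans ⟨iso.toEmbedding.comp Embedding.sumInr⟩
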